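/- Proposition 3.13. Let $\mathcal{A}',\mathcal{A},\mathcal{A}''$ be abelian categories with enough projective and enough injective objects, and let $(\mathcal{A}',\mathcal{A},\mathcal{A}'',i^*,i_*,i^!,j_!,j^*,j_*)$ be a recollement: $i_*:\mathcal{A}'\to\mathcal{A}$ has left adjoint $i^*$ and right adjoint $i^!$, $j^*:\mathcal{A}\to\mathcal{A}''$ has left adjoint $j_!$ and right adjoint $j_*$, the functors $i_*,j_!,j_*$ are fully faithful, and $\operatorname{Ker} j^*$ is the essential image of $i_*$. Assume condition (P): the counit $j_!j^*P\to P$ is a monomorphism for every projective object $P$ of $\mathcal{A}$. For a class of objects $\mathcal{C}$ of an abelian category let $\mathcal{C}^{\perp}=\{X\mid \operatorname{Ext}^1(C,X)=0 \text{ for all } C\in\mathcal{C}\}$ and ${}^{\perp}\mathcal{C}=\{X\mid \operatorname{Ext}^1(X,C)=0 \text{ for all } C\in\mathcal{C}\}$. A pair $(\mathcal{C},\mathcal{D})$ is a cotorsion pair if $\mathcal{C}^{\perp}=\mathcal{D}$ and ${}^{\perp}\mathcal{D}=\mathcal{C}$. It is complete if for every object $M$ there are short exact sequences $0\to D_1\to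 C_1\to M\to 0$ and $0\to M\to D_2\to C_2\to 0$ with $C_1,C_2\in\mathcal{C}$ and $D_1,D_2\in\mathcal{D}$. It is hereditary if $\mathcal{C}$ is closed under kernels of epimorphisms between its objects and $\mathcal{D}$ is closed under cokernels of monomorphisms between its objects. Let $\mathcal{U}',\mathcal{V}'$ be classes of objects of $\mathcal{A}'$ and $\mathcal{U}'',\mathcal{V}''$ classes of objects of $\mathcal{A}''$, all closed under isomorphisms, and put $$\mathcal{M}^{\mathcal{U}'}_{\mathcal{U}''}=\{X\in\mathcal{A}\mid i^*X\in\mathcal{U}',\ j^*X\in\mathcal{U}'',\ (\mathbb{L}_1i^*)(X)=0\},$$ $$\mathcal{N}^{\mathcal{V}'}_{\mathcal{V}''}=\{X\in\mathcal{A}\mid i^!X\in\mathcal{V}',\ j^*X\in\mathcal{V}'',\ (\mathbb{R}_1i^!)(X)=0\},$$ where $\mathbb{L}_1$ and $\mathbb{R}_1$ denote first left and right derived functors. Assume that $(\mathcal{M}^{\mathcal{U}'}_{\mathcal{U}''},\mathcal{N}^{\mathcal{V}'}_{\mathcal{V}''})$ is a complete hereditary cotorsion pair in $\mathcal{A}$,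 that $(\mathbb{R}_1j_*)(Y)=0$ for all $Y\in\mathcal{U}''^{\perp}$, that $(\mathbb{L}_1j_!)(Y)=0$ for all $Y\in{}^{\perp}\mathcal{V}''$, and that either $(\mathbb{L}_1j_!)(Y)=0$ for all $Y\in\mathcal{U}''$ or $(\mathbb{R}_1j_*)(Y)=0$ for all $Y\in\mathcal{V}''$. Assume moreover that at least one of the following holds: (1) $i^*j_*Y\in\mathcal{V}'$ and $(\mathbb{L}_1i^*)(j_*Y)=0$ for all $Y\in\mathcal{V}''$; (2) $i^!j_!Y\in\mathcal{U}'$ and $(\mathbb{R}_1i^!)(j_!Y)=0$ for all $Y\in\mathcal{U}''$. Then $(\mathcal{U}',\mathcal{V}')$ and $(\mathcal{U}'',\mathcal{V}'')$ are complete hereditary cotorsion pairs in $\mathcal{A}'$ and $\mathcal{A}''$, respectively. -/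

import Mathlib

open CategoryTheory CategoryTheory.Limits

universe v' v v'' u' u u''

/-- `Ext¹(X, Y) = 0`. In the presence of enough projectives, Mathlib's `Ext` groups live in the
universe of morphisms of the category. -/
def ExtOneVanishes {C : Type u} [Category.{v} C] [Abelian C] [EnoughProjectives C]
    (X Y : C) : Prop :=
  haveI : HasExt.{v} C := hasExt_of_enoughProjectives.{v} C
  Subsingleton (Abelian.Ext.{v} X Y 1)

/-- `𝒞^⊥`: the objects `X` with `Ext¹(Z, X) = 0` for all `Z ∈ 𝒞`. -/
def rightExtPerp {C : Type u} [Category.{v} C] [Abelian C] [EnoughProjectives C]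
    (𝒞 : ObjectProperty C) : ObjectProperty C :=
  fun X => ∀ Z : C, 𝒞 Z → ExtOneVanishes Z X

/-- `^⊥𝒟`: the objects `Y` with `Ext¹(Y, D) = 0` for all `D ∈ 𝒟`. -/
def leftExtPerp {C : Type u} [Category.{v} C] [Abelian C] [EnoughProjectives C]
    (𝒟 : ObjectProperty C) : ObjectProperty C :=
  fun Y => ∀ D : C, 𝒟 D → ExtOneVanishes Y D

/-- A cotorsion pair in an abelian category with enough projectives. -/
structure IsCotorsionPair {C : Type u} [Category.{v} C] [Abelian C] [EnoughProjectives C]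
    (𝒞 𝒟 : ObjectProperty C) : Prop where
  rightPerp_eq : rightExtPerp 𝒞 = 𝒟
  leftPerp_eq : leftExtPerp 𝒟 = 𝒞

/-- Completeness of a pair of classes: every object `M` fits into short exact sequences
`0 → D₁ → C₁ → M → 0` and `0 → M → D₂ → C₂ → 0` with `Cᵢ ∈ 𝒞` and `Dᵢ ∈ 𝒟`. -/
structure IsCompletePair {C : Type u} [Category.{v} C] [Abelian C]
    (𝒞 𝒟 : ObjectProperty C) : Prop where
  exists_precover : ∀ M : C, ∃ (D₁ C₁ : C) (k : D₁ ⟶ C₁) (f : C₁ ⟶ M) (w : k ≫ f = 0),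
    (ShortComplex.mk k f w).ShortExact ∧ 𝒞 C₁ ∧ 𝒟 D₁
  exists_preenvelope : ∀ M : C, ∃ (D₂ C₂ : C) (g : M ⟶ D₂) (p : D₂ ⟶ C₂) (w : g ≫ p = 0),
    (ShortComplex.mk g p w).ShortExact ∧ 𝒞 C₂ ∧ 𝒟 D₂

/-- Heredity of a pair of classes: `𝒞` is closed under kernels of epimorphisms and `𝒟` is closed
under cokernels of monomorphisms. -/
structure IsHereditaryPair {C : Type u} [Category.{v} C] [Abelian C]
    (𝒞 𝒟 : ObjectProperty C) : Prop where
  kernel_mem : ∀ S : ShortComplex C, S.ShortExact → 𝒞 S.X₂ → 𝒞 S.X₃ → 𝒞 S.X₁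
  cokernel_mem : ∀ S : ShortComplex C, S.ShortExact → 𝒟 S.X₁ → 𝒟 S.X₂ → 𝒟 S.X₃

/-- A complete hereditary cotorsion pair. -/
structure IsCompleteHereditaryCotorsionPair {C : Type u} [Category.{v} C] [Abelian C]
    [EnoughProjectives C] (𝒞 𝒟 : ObjectProperty C) : Prop where
  cotorsion : IsCotorsionPair 𝒞 𝒟
  complete : IsCompletePair 𝒞 𝒟
  hereditary : IsHereditaryPair 𝒞 𝒟

/-- A recollement of the abelian category `A` relative to `A'` and `A''`. -/
structure AbelianRecollement (A' : Type u') [Category.{v'} A'] [Abelian A']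
    (A : Type u) [Category.{v} A] [Abelian A]
    (A'' : Type u'') [Category.{v''} A''] [Abelian A''] where
  /-- the functor `i^*` -/
  iUpperStar : A ⥤ A'
  /-- the functor `i_*` -/
  iLowerStar : A' ⥤ A
  /-- the functor `i^!` -/
  iUpperShriek : A ⥤ A'
  /-- the functor `j_!` -/
  jLowerShriek : A'' ⥤ A
  /-- the functor `j^*` -/
  jUpperStar : A ⥤ A''
  /-- the functor `j_*` -/
  jLowerStar : A'' ⥤ A
  /-- `i^* ⊣ i_*` -/
  adjIStar : iUpperStar ⊣ iLowerStar
  /-- `i_* ⊣ i^!` -/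
  adjIShriek : iLowerStar ⊣ iUpperShriek
  /-- `j_! ⊣ j^*` -/
  adjJShriek : jLowerShriek ⊣ jUpperStar
  /-- `j^* ⊣ j_*` -/
  adjJStar : jUpperStar ⊣ jLowerStar
  full_iLowerStar : iLowerStar.Full
  faithful_iLowerStar : iLowerStar.Faithful
  full_jLowerShriek : jLowerShriek.Full
  faithful_jLowerShriek : jLowerShriek.Faithful
  full_jLowerStar : jLowerStar.Full
  faithful_jLowerStar : jLowerStar.Faithful
  /-- `Ker j^* = Im i_*` (essential image) -/
  kernel_eq_image : ∀ X : A, IsZero (jUpperStar.obj X) ↔ iLowerStar.essImage X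

namespace AbelianRecollement

section

variable {A' : Type u'} [Category.{v'} A'] [Abelian A']
  {A : Type u} [Category.{v} A] [Abelian A]
  {A'' : Type u''} [Category.{v''} A''] [Abelian A'']
  (R : AbelianRecollement A' A A'')

instance additive_iLowerStar : R.iLowerStar.Additive := by
  have := R.adjIStar.rightAdjoint_preservesLimits
  exact R.iLowerStar.additive_of_preserves_binary_products

instance additive_jUpperStar : R.jUpperStar.Additive := by
  have := R.adjJShriek.rightAdjoint_preservesLimits
  exact R.jUpperStar.additive_of_preserves_binary_products

instance additive_iUpperStar : R.iUpperStar.Additive :=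
  R.adjIStar.left_adjoint_additive

instance additive_iUpperShriek : R.iUpperShriek.Additive :=
  R.adjIShriek.right_adjoint_additive

instance additive_jLowerShriek : R.jLowerShriek.Additive :=
  R.adjJShriek.left_adjoint_additive

instance additive_jLowerStar : R.jLowerStar.Additive :=
  R.adjJStar.right_adjoint_additive

/-- Condition (P): the counit `j_! j^* P ⟶ P` is a monomorphism for every projective `P`. -/
def ConditionP : Prop :=
  ∀ P : A, Projective P → Mono (R.adjJShriek.counit.app P)

/-- The class `ℳ^𝒳_𝒴` of all `X` with `i^* X ∈ 𝒳`, `j^* X ∈ 𝒴` and `(L₁ i^*) X = 0`. -/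
def gluedM [EnoughProjectives A] (𝒳 : ObjectProperty A') (𝒴 : ObjectProperty A'') :
    ObjectProperty A :=
  fun X => 𝒳 (R.iUpperStar.obj X) ∧ 𝒴 (R.jUpperStar.obj X) ∧
    IsZero ((R.iUpperStar.leftDerived 1).obj X)

/-- The class `𝒩^𝒳_𝒴` of all `X` with `i^! X ∈ 𝒳`, `j^* X ∈ 𝒴` and `(R₁ i^!) X = 0`. -/
def gluedN [EnoughInjectives A] (𝒳 : ObjectProperty A') (𝒴 : ObjectProperty A'') :
    ObjectProperty A :=
  fun X => 𝒳 (R.iUpperShriek.obj X) ∧ 𝒴 (R.jUpperStar.obj X) ∧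
    IsZero ((R.iUpperShriek.rightDerived 1).obj X)

end

end AbelianRecollement

/-!
Passing to opposite categories turns a recollement into a recollement, exchanging `i^*` with `i^!`,
`j_!` with `j_*` and `ℳ` with `𝒩`, so every argument is needed on one side only.

`L₁ i^*` vanishes on the images of `i_*` and of `j_!`, hence `i_* X ∈ ℳ` iff `X ∈ U'` and
`j_! Y ∈ ℳ` iff `Y ∈ U''`. For an adjunction `F ⊣ G` with `G` exact and an object `X` with
`L₁ F X = 0`, one has `Ext¹(F X, Y) = 0` iff `Ext¹(X, G Y) = 0`; moreover
`Ext¹(j_! X, j_* Y) = 0` iff `Ext¹(X, Y) = 0`, because `j^*` is exact and sends the projectives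
`j_! P` to projectives.

For `X ∈ ℳ`, heredity puts the kernel of `X ⟶ i_* i^* X` into `ℳ`. The kernel of
`j_! j^* X ⟶ X` is annihilated by `j^*`, and by `i^*` as soon as `L₁ i^*` vanishes on the image, so
`0 ⟶ j_! j^* X ⟶ X ⟶ i_* i^* X ⟶ 0` is exact. Under (2), applying `i^!` to this sequence shows
`i^! X ∈ U'`, and `i^!` carries the approximations of `i_* M` to approximations of `M`.
-/

section Ext

variable {C : Type u} [Category.{v} C] [Abelian C]

theorem exists_projective_presentation [EnoughProjectives C] (X : C) :
    ∃ S : ShortComplex C, S.ShortExact ∧ Projective S.X₂ ∧ S.X₃ = X :=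
  ⟨ShortComplex.mk (kernel.ι (Projective.π X)) (Projective.π X) (kernel.condition _),
    { exact := ShortComplex.exact_kernel _ }, Projective.projective_over X, rfl⟩

theorem exists_injective_copresentation [EnoughInjectives C] (X : C) :
    ∃ S : ShortComplex C, S.ShortExact ∧ Injective S.X₂ ∧ S.X₁ = X :=
  ⟨ShortComplex.mk (Injective.ι X) (cokernel.π (Injective.ι X)) (cokernel.condition _),
    { exact := ShortComplex.exact_cokernel _ }, Injective.injective_under X, rfl⟩

variable [EnoughProjectives C]

theorem extOneVanishes_of_projective (X Y : C) [Projective X] : ExtOneVanishes X Y :=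
  have : HasExt.{v} C := hasExt_of_enoughProjectives.{v} C
  subsingleton_of_forall_eq (α := Abelian.Ext.{v} X Y 1) 0
    fun _ ↦ Abelian.Ext.eq_zero_of_projective _

theorem extOneVanishes_congr_left {X X' : C} (e : X ≅ X') (Y : C) :
    ExtOneVanishes X Y ↔ ExtOneVanishes X' Y :=
  have : HasExt.{v} C := hasExt_of_enoughProjectives.{v} C
  (((Abelian.extFunctor.{v} 1).mapIso e.symm.op).app Y).addCommGroupIsoToAddEquiv.subsingleton_congr

theorem extOneVanishes_iff_surjective_precomp {S : ShortComplex C} (hS : S.ShortExact)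
    [Projective S.X₂] (Y : C) :
    ExtOneVanishes S.X₃ Y ↔ Function.Surjective fun ψ : S.X₂ ⟶ Y ↦ S.f ≫ ψ := by
  have : HasExt.{v} C := hasExt_of_enoughProjectives.{v} C
  constructor
  · intro (_ : Subsingleton (Abelian.Ext.{v} S.X₃ Y 1)) φ
    obtain ⟨x, hx⟩ := Abelian.Ext.contravariant_sequence_exact₁ hS (Y := Y) (Abelian.Ext.mk₀ φ)
      (add_zero 1) (Subsingleton.elim _ _)
    obtain ⟨ψ, rfl⟩ := (Abelian.Ext.mk₀_bijective _ _).2 x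
    exact ⟨ψ, (Abelian.Ext.mk₀_bijective _ _).1 ((Abelian.Ext.mk₀_comp_mk₀ _ _).symm.trans hx)⟩
  · intro h
    refine subsingleton_of_forall_eq (α := Abelian.Ext.{v} S.X₃ Y 1) 0 fun x ↦ ?_
    obtain ⟨y, rfl⟩ := Abelian.Ext.contravariant_sequence_exact₃ hS (Y := Y) x
      (Abelian.Ext.eq_zero_of_projective _) (add_zero 1)
    obtain ⟨φ, rfl⟩ := (Abelian.Ext.mk₀_bijective _ _).2 y
    obtain ⟨ψ, rfl⟩ := h φ
    rw [← Abelian.Ext.mk₀_comp_mk₀]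
    exact hS.extClass_comp_assoc _

theorem extOneVanishes_iff_surjective_postcomp {S : ShortComplex C} (hS : S.ShortExact)
    [Injective S.X₂] (X : C) :
    ExtOneVanishes X S.X₁ ↔ Function.Surjective fun ψ : X ⟶ S.X₂ ↦ ψ ≫ S.g := by
  have : HasExt.{v} C := hasExt_of_enoughProjectives.{v} C
  constructor
  · intro (_ : Subsingleton (Abelian.Ext.{v} X S.X₁ 1)) φ
    obtain ⟨x, hx⟩ := Abelian.Ext.covariant_sequence_exact₃ X hS (Abelian.Ext.mk₀ φ)
      (zero_add 1) (Subsingleton.elim _ _)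
    obtain ⟨ψ, rfl⟩ := (Abelian.Ext.mk₀_bijective _ _).2 x
    exact ⟨ψ, (Abelian.Ext.mk₀_bijective _ _).1 ((Abelian.Ext.mk₀_comp_mk₀ _ _).symm.trans hx)⟩
  · intro h
    refine subsingleton_of_forall_eq (α := Abelian.Ext.{v} X S.X₁ 1) 0 fun x ↦ ?_
    obtain ⟨y, rfl⟩ := Abelian.Ext.covariant_sequence_exact₁ X hS x
      (Abelian.Ext.eq_zero_of_injective _) (zero_add 1)
    obtain ⟨φ, rfl⟩ := (Abelian.Ext.mk₀_bijective _ _).2 y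
    obtain ⟨ψ, rfl⟩ := h φ
    rw [← Abelian.Ext.mk₀_comp_mk₀, Abelian.Ext.comp_assoc_of_second_deg_zero, hS.comp_extClass,
      Abelian.Ext.comp_zero]

theorem ExtOneVanishes.of_shortExact_left {S : ShortComplex C} (hS : S.ShortExact) {Y : C}
    (h₁ : ExtOneVanishes S.X₁ Y) (h₃ : ExtOneVanishes S.X₃ Y) : ExtOneVanishes S.X₂ Y := by
  have : HasExt.{v} C := hasExt_of_enoughProjectives.{v} C
  have : Subsingleton (Abelian.Ext.{v} S.X₁ Y 1) := h₁
  have : Subsingleton (Abelian.Ext.{v} S.X₃ Y 1) := h₃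
  refine subsingleton_of_forall_eq (α := Abelian.Ext.{v} S.X₂ Y 1) 0 fun x ↦ ?_
  obtain ⟨y, rfl⟩ := Abelian.Ext.contravariant_sequence_exact₂ hS Y x (Subsingleton.elim _ _)
  rw [Subsingleton.elim y 0, Abelian.Ext.comp_zero]

theorem extOneVanishes_op_iff [EnoughInjectives C] (X Y : C) :
    ExtOneVanishes (Opposite.op Y) (Opposite.op X) ↔ ExtOneVanishes X Y := by
  obtain ⟨S, hS, hI, rfl⟩ := exists_injective_copresentation Y
  have : Projective S.op.X₂ := inferInstanceAs (Projective (Opposite.op S.X₂))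
  rw [extOneVanishes_iff_surjective_postcomp hS X]
  refine (extOneVanishes_iff_surjective_precomp hS.op (Opposite.op X)).trans
    ⟨fun h φ ↦ ?_, fun h φ ↦ ?_⟩
  · obtain ⟨ψ, hψ⟩ := h φ.op
    exact ⟨ψ.unop, Quiver.Hom.op_inj hψ⟩
  · obtain ⟨ψ, hψ⟩ := h φ.unop
    exact ⟨ψ.op, Quiver.Hom.unop_inj hψ⟩

end Ext

section Derived

variable {C : Type u} [Category.{v} C] [Abelian C] {D : Type u'} [Category.{v'} D] [Abelian D]

theorem isPushout_of_shortExact_of_isIso_τ₃ {T S : ShortComplex C} (hT : T.ShortExact)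
    (hS : S.ShortExact) (φ : T ⟶ S) [IsIso φ.τ₃] : IsPushout T.f φ.τ₁ φ.τ₂ S.f := by
  have := hT.mono_f
  have := hT.epi_g
  have hQ := IsPushout.of_hasPushout T.f φ.τ₁
  let Q : ShortComplex C :=
    .mk (pushout.inr T.f φ.τ₁) (hQ.desc T.g 0 (by simp)) (hQ.inr_desc _ _ _)
  let ψ : Q ⟶ S :=
    { τ₁ := 𝟙 _
      τ₂ := hQ.desc φ.τ₂ S.f φ.comm₁₂.symm
      τ₃ := φ.τ₃
      comm₁₂ := by simp [Q]
      comm₂₃ := hQ.hom_ext (by simp [Q, φ.comm₂₃]) (by simp [Q]) }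
  have exact_Q : Q.Exact := by
    rw [ShortComplex.exact_iff_exact_up_to_refinements]
    intro A x hx
    obtain ⟨A', π, hπ, t, s, hts⟩ := hQ.hom_eq_add_up_to_refinements x
    have ht : t ≫ T.g = 0 := by simpa [hx, Q] using (hts =≫ Q.g).symm
    obtain ⟨r, rfl⟩ := hT.exact.lift' t ht
    exact ⟨A', π, hπ, r ≫ φ.τ₁ + s, by simp [hts, pushout.condition, Q]⟩
  have shortExact_Q : Q.ShortExact :=
    { exact := exact_Q
      mono_f := inferInstanceAs (Mono (pushout.inr T.f φ.τ₁))
      epi_g := epi_of_epi_fac (hQ.inl_desc T.g 0 (by simp)) }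
  have : IsIso ψ.τ₂ := ShortComplex.isIso₂_of_shortExact_of_isIso₁₃ ψ shortExact_Q hS
  exact hQ.of_iso (Iso.refl _) (Iso.refl _) (Iso.refl _) (asIso ψ.τ₂)
    (by simp) (by simp) (by simp [ψ]) (by simp [ψ])

theorem mono_map_f_of_projective (F : C ⥤ D) [PreservesFiniteColimits F] {T S : ShortComplex C}
    (hT : T.ShortExact) (hS : S.ShortExact) [Projective T.X₂] (e : T.X₃ ≅ S.X₃)
    [Mono (F.map T.f)] : Mono (F.map S.f) := by
  have := hS.epi_g
  have := hS.mono_f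
  let b : T.X₂ ⟶ S.X₂ := Projective.factorThru (T.g ≫ e.hom) S.g
  have hb : b ≫ S.g = T.g ≫ e.hom := Projective.factorThru_comp _ _
  let a : T.X₁ ⟶ S.X₁ := hS.exact.lift (T.f ≫ b) (by simp [hb])
  let φ : T ⟶ S := { τ₁ := a, τ₂ := b, τ₃ := e.hom, comm₁₂ := by simp [a], comm₂₃ := hb }
  have hφ := (isPushout_of_shortExact_of_isIso_τ₃ hT hS φ).map F
  exact Abelian.mono_inr_of_isColimit _ _ hφ.isColimit

theorem epi_map_g_of_injective (F : C ⥤ D) [PreservesFiniteLimits F] {T S : ShortComplex C}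
    (hT : T.ShortExact) (hS : S.ShortExact) [Injective T.X₂] (e : T.X₁ ≅ S.X₁)
    [Epi (F.map T.g)] : Epi (F.map S.g) := by
  have := preservesFiniteColimits_op F
  have : Projective T.op.X₂ := inferInstanceAs (Projective (Opposite.op T.X₂))
  have : Mono (F.op.map T.op.f) := inferInstanceAs (Mono (F.map T.g).op)
  exact (op_mono_iff _).1 (mono_map_f_of_projective F.op hT.op hS.op e.symm.op)

theorem exact_comp_iff_mono {S : ShortComplex C} (hS : S.Exact) [Epi S.g] {Z : C}
    (k : S.X₃ ⟶ Z) : (ShortComplex.mk S.f (S.g ≫ k) (by simp)).Exact ↔ Mono k := by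
  let e : cokernel S.f ≅ S.X₃ := (cokernelIsCokernel S.f).coconePointUniqueUpToIso hS.gIsCokernel
  have he : cokernel.π S.f ≫ e.hom = S.g :=
    (cokernelIsCokernel S.f).comp_coconePointUniqueUpToIso_hom hS.gIsCokernel .one
  have hk : cokernel.desc S.f (S.g ≫ k) (by simp) = e.hom ≫ k := by
    rw [← cancel_epi (cokernel.π S.f), cokernel.π_desc, reassoc_of% he]
  rw [ShortComplex.exact_iff_mono_cokernel_desc, hk]
  exact mono_comp_iff_of_isIso e.hom k

theorem exact_map_iff_mono (F : C ⥤ D) [F.Additive] [PreservesFiniteColimits F]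
    {S : ShortComplex C} (hS : S.Exact) {K : C} (p : S.X₂ ⟶ K) (k : K ⟶ S.X₃) [Epi p] [Mono k]
    (hpk : p ≫ k = S.g) : (S.map F).Exact ↔ Mono (F.map k) := by
  have hp : S.f ≫ p = 0 := by rw [← cancel_mono k, Category.assoc, hpk, S.zero, zero_comp]
  let T : ShortComplex C := .mk S.f p hp
  have hT : T.Exact := by
    let φ : T ⟶ S :=
      { τ₁ := 𝟙 _, τ₂ := 𝟙 _, τ₃ := k, comm₁₂ := by simp [T], comm₂₃ := by simp [T, hpk] }
    exact (ShortComplex.exact_iff_of_epi_of_isIso_of_mono φ).2 hS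
  have : Epi (T.map F).g := inferInstanceAs (Epi (F.map p))
  have hFT := hT.map_of_epi_of_preservesCokernel F inferInstance inferInstance
  simpa [T, ← F.map_comp, hpk, ShortComplex.map] using exact_comp_iff_mono hFT (F.map k)

theorem exact_map_iff_epi (F : C ⥤ D) [F.Additive] [PreservesFiniteLimits F]
    {S : ShortComplex C} (hS : S.Exact) {K : C} (p : S.X₁ ⟶ K) (k : K ⟶ S.X₂) [Epi p] [Mono k]
    (hpk : p ≫ k = S.f) : (S.map F).Exact ↔ Epi (F.map p) := by
  have := preservesFiniteColimits_op F
  rw [← op_mono_iff, ← ShortComplex.exact_op_iff]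
  let k' : S.op.X₂ ⟶ Opposite.op K := k.op
  let p' : Opposite.op K ⟶ S.op.X₃ := p.op
  have : Epi k' := inferInstanceAs (Epi k.op)
  have : Mono p' := inferInstanceAs (Mono p.op)
  exact exact_map_iff_mono F.op hS.op k' p' (congrArg Quiver.Hom.op hpk)

theorem isZero_leftDerived_one_iff_exact [EnoughProjectives C] (F : C ⥤ D) [F.Additive] {X : C}
    (P : ProjectiveResolution X) :
    IsZero ((F.leftDerived 1).obj X) ↔
      ((ShortComplex.mk _ _ (P.complex.d_comp_d 2 1 0)).map F).Exact := by
  rw [(P.isoLeftDerivedObj F 1).isZero_iff]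
  refine (HomologicalComplex.exactAt_iff_isZero_homology _ _).symm.trans ?_
  rw [HomologicalComplex.exactAt_iff' _ 2 1 0 (by simp) (by simp)]
  rfl

theorem isZero_rightDerived_one_iff_exact [EnoughInjectives C] (F : C ⥤ D) [F.Additive] {X : C}
    (I : InjectiveResolution X) :
    IsZero ((F.rightDerived 1).obj X) ↔
      ((ShortComplex.mk _ _ (I.cocomplex.d_comp_d 0 1 2)).map F).Exact := by
  rw [(I.isoRightDerivedObj F 1).isZero_iff]
  refine (HomologicalComplex.exactAt_iff_isZero_homology _ _).symm.trans ?_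
  rw [HomologicalComplex.exactAt_iff' _ 0 1 2 (by simp) (by simp)]
  rfl

theorem isZero_leftDerived_one_iff [EnoughProjectives C] (F : C ⥤ D) [F.Additive]
    [PreservesFiniteColimits F] {S : ShortComplex C} (hS : S.ShortExact) [Projective S.X₂] :
    IsZero ((F.leftDerived 1).obj S.X₃) ↔ Mono (F.map S.f) := by
  let P := projectiveResolution S.X₃
  let q : P.complex.X 0 ⟶ S.X₃ := P.π.f 0
  have : Epi q := inferInstanceAs (Epi (P.π.f 0))
  let T : ShortComplex C := .mk (kernel.ι q) q (kernel.condition q)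
  have hT : T.ShortExact := { exact := ShortComplex.exact_kernel q }
  let p : P.complex.X 1 ⟶ kernel q := kernel.lift q (P.complex.d 1 0) P.complex_d_comp_π_f_zero
  have : Epi p := P.exact₀.epi_kernelLift
  let e : T.X₃ ≅ S.X₃ := Iso.refl _
  rw [isZero_leftDerived_one_iff_exact F P,
    exact_map_iff_mono F (P.exact_succ 0) p (kernel.ι q) (kernel.lift_ι _ _ _)]
  exact ⟨fun h ↦ have : Mono (F.map T.f) := h; mono_map_f_of_projective F hT hS e,
    fun h ↦ mono_map_f_of_projective F hS hT e.symm⟩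

theorem isZero_rightDerived_one_iff [EnoughInjectives C] (F : C ⥤ D) [F.Additive]
    [PreservesFiniteLimits F] {S : ShortComplex C} (hS : S.ShortExact) [Injective S.X₂] :
    IsZero ((F.rightDerived 1).obj S.X₁) ↔ Epi (F.map S.g) := by
  let I := injectiveResolution S.X₁
  let q : S.X₁ ⟶ I.cocomplex.X 0 := I.ι.f 0
  have : Mono q := inferInstanceAs (Mono (I.ι.f 0))
  let T : ShortComplex C := .mk q (cokernel.π q) (cokernel.condition q)
  have hT : T.ShortExact := { exact := ShortComplex.exact_cokernel q }
  let p : cokernel q ⟶ I.cocomplex.X 1 :=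
    cokernel.desc q (I.cocomplex.d 0 1) I.ι_f_zero_comp_complex_d
  have : Mono p := I.exact₀.mono_cokernelDesc
  let e : T.X₁ ≅ S.X₁ := Iso.refl _
  rw [isZero_rightDerived_one_iff_exact F I,
    exact_map_iff_epi F (I.exact_succ 0) (cokernel.π q) p (cokernel.π_desc _ _ _)]
  exact ⟨fun h ↦ have : Epi (F.map T.g) := h; epi_map_g_of_injective F hT hS e,
    fun h ↦ epi_map_g_of_injective F hS hT e.symm⟩

theorem isZero_leftDerived_one_op_iff [EnoughInjectives C] (F : C ⥤ D) [F.Additive]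
    [PreservesFiniteLimits F] (X : C) :
    IsZero ((F.op.leftDerived 1).obj (Opposite.op X)) ↔ IsZero ((F.rightDerived 1).obj X) := by
  obtain ⟨S, hS, hI, rfl⟩ := exists_injective_copresentation X
  have : Projective S.op.X₂ := inferInstanceAs (Projective (Opposite.op S.X₂))
  have := preservesFiniteColimits_op F
  rw [isZero_rightDerived_one_iff F hS, ← op_mono_iff]
  exact isZero_leftDerived_one_iff F.op hS.op

theorem isZero_rightDerived_one_op_iff [EnoughProjectives C] (F : C ⥤ D) [F.Additive]
    [PreservesFiniteColimits F] (X : C) :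
    IsZero ((F.op.rightDerived 1).obj (Opposite.op X)) ↔ IsZero ((F.leftDerived 1).obj X) := by
  obtain ⟨S, hS, hP, rfl⟩ := exists_projective_presentation X
  have : Injective S.op.X₂ := inferInstanceAs (Injective (Opposite.op S.X₂))
  have := preservesFiniteLimits_op F
  rw [isZero_leftDerived_one_iff F hS, ← op_epi_iff]
  exact isZero_rightDerived_one_iff F.op hS.op

theorem shortExact_map_of_isZero_leftDerived [EnoughProjectives C] (F : C ⥤ D) [F.Additive]
    [PreservesFiniteColimits F] {S : ShortComplex C} (hS : S.ShortExact)
    (h : IsZero ((F.leftDerived 1).obj S.X₃)) : (S.map F).ShortExact := by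
  obtain ⟨T, hT, hTP, hTS⟩ := exists_projective_presentation S.X₃
  rw [← hTS, isZero_leftDerived_one_iff F hT] at h
  have := hS.epi_g
  exact
    { exact := hS.exact.map_of_epi_of_preservesCokernel F hS.epi_g inferInstance
      mono_f := mono_map_f_of_projective F hT hS (eqToIso hTS)
      epi_g := inferInstanceAs (Epi (F.map S.g)) }

theorem shortExact_map_of_isZero_rightDerived [EnoughInjectives C] (F : C ⥤ D) [F.Additive]
    [PreservesFiniteLimits F] {S : ShortComplex C} (hS : S.ShortExact)
    (h : IsZero ((F.rightDerived 1).obj S.X₁)) : (S.map F).ShortExact :=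
  have := preservesFiniteColimits_op F
  (shortExact_map_of_isZero_leftDerived F.op hS.op
    ((isZero_leftDerived_one_op_iff F S.X₁).2 h)).unop

theorem mono_f_of_exact_columns {S₁ S₂ S₃ : ShortComplex C} (φ : S₁ ⟶ S₂) (ψ : S₂ ⟶ S₃)
    (zero : φ ≫ ψ = 0) (hS₁ : S₁.Exact) [Mono S₂.f] [Mono φ.τ₃] [Epi ψ.τ₁]
    (hφψ : (ShortComplex.mk φ.τ₂ ψ.τ₂ (congrArg ShortComplex.Hom.τ₂ zero)).Exact) : Mono S₃.f := by
  rw [Preadditive.mono_iff_cancel_zero]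
  intro A z hz
  obtain ⟨A₁, π₁, _, k, hk⟩ := surjective_up_to_refinements_of_epi ψ.τ₁ z
  obtain ⟨A₂, π₂, _, y, (hy : π₂ ≫ k ≫ S₂.f = y ≫ φ.τ₂)⟩ :=
    hφψ.exact_up_to_refinements (k ≫ S₂.f) (by
      rw [Category.assoc, ← ψ.comm₁₂, ← reassoc_of% hk, hz, comp_zero])
  have hyg : y ≫ S₁.g = 0 := by
    rw [← cancel_mono φ.τ₃, Category.assoc, ← φ.comm₂₃, ← reassoc_of% hy]
    simp
  obtain ⟨A₃, π₃, _, w, hw⟩ := hS₁.exact_up_to_refinements y hyg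
  have hkw : π₃ ≫ π₂ ≫ k = w ≫ φ.τ₁ := by
    rw [← cancel_mono S₂.f]
    simp only [Category.assoc, hy, reassoc_of% hw, φ.comm₁₂]
  have zero₁ : φ.τ₁ ≫ ψ.τ₁ = 0 := congrArg ShortComplex.Hom.τ₁ zero
  rw [← cancel_epi π₁, ← cancel_epi π₂, ← cancel_epi π₃, hk, reassoc_of% hkw, zero₁]
  simp only [comp_zero]

end Derived

section Adjunction

variable {C : Type u} [Category.{v} C] {D : Type u'} [Category.{v'} D] {F : C ⥤ D} {G : D ⥤ C}

theorem surjective_map_comp_iff (adj : F ⊣ G) {X₁ X₂ : C} (f : X₁ ⟶ X₂) (Y : D) :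
    (Function.Surjective fun ψ : F.obj X₂ ⟶ Y ↦ F.map f ≫ ψ) ↔
      Function.Surjective fun ψ : X₂ ⟶ G.obj Y ↦ f ≫ ψ := by
  rw [← (adj.homEquiv X₁ Y).comp_surjective, ← (adj.homEquiv X₂ Y).surjective_comp]
  refine iff_of_eq (congrArg _ (funext fun ψ ↦ ?_))
  exact adj.homEquiv_naturality_left f ψ

variable [Abelian C] [Abelian D] [EnoughProjectives C] [EnoughProjectives D]

theorem extOneVanishes_obj_iff_of_shortExact_map (adj : F ⊣ G) [F.PreservesZeroMorphisms]
    {S : ShortComplex C} (hS : S.ShortExact) (hFS : (S.map F).ShortExact) [Projective S.X₂]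
    [Projective (F.obj S.X₂)] (Y : D) :
    ExtOneVanishes (F.obj S.X₃) Y ↔ ExtOneVanishes S.X₃ (G.obj Y) := by
  have : Projective (S.map F).X₂ := inferInstanceAs (Projective (F.obj S.X₂))
  rw [extOneVanishes_iff_surjective_precomp hS, ← surjective_map_comp_iff adj]
  exact extOneVanishes_iff_surjective_precomp hFS Y

theorem extOneVanishes_obj_iff_of_isZero_leftDerived (adj : F ⊣ G) [F.Additive]
    [G.PreservesEpimorphisms] {X : C} (hX : IsZero ((F.leftDerived 1).obj X)) (Y : D) :
    ExtOneVanishes (F.obj X) Y ↔ ExtOneVanishes X (G.obj Y) := by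
  have := adj.leftAdjoint_preservesColimits
  obtain ⟨S, hS, hP, rfl⟩ := exists_projective_presentation X
  have := adj.map_projective _ hP
  exact extOneVanishes_obj_iff_of_shortExact_map adj hS
    (shortExact_map_of_isZero_leftDerived F hS hX) Y

end Adjunction

section CotorsionPair

variable {C : Type u} [Category.{v} C] [Abelian C] {𝒞 𝒟 : ObjectProperty C}

section

variable [EnoughProjectives C]

theorem IsCotorsionPair.extOneVanishes (h : IsCotorsionPair 𝒞 𝒟) {X Y : C} (hX : 𝒞 X)
    (hY : 𝒟 Y) : ExtOneVanishes X Y := by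
  rw [← h.leftPerp_eq] at hX
  exact hX Y hY

theorem IsCotorsionPair.of_le (h : ∀ X Y, 𝒞 X → 𝒟 Y → ExtOneVanishes X Y)
    (hr : rightExtPerp 𝒞 ≤ 𝒟) (hl : leftExtPerp 𝒟 ≤ 𝒞) : IsCotorsionPair 𝒞 𝒟 where
  rightPerp_eq := le_antisymm hr fun Y hY X hX ↦ h X Y hX hY
  leftPerp_eq := le_antisymm hl fun X hX Y hY ↦ h X Y hX hY

theorem IsCotorsionPair.containsZero_left (h : IsCotorsionPair 𝒞 𝒟) : 𝒞.ContainsZero := by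
  obtain ⟨Z, hZ⟩ := HasZeroObject.zero (C := C)
  have : Projective Z := hZ.projective
  exact ⟨Z, hZ, h.leftPerp_eq.le Z fun Y _ ↦ extOneVanishes_of_projective Z Y⟩

theorem IsCotorsionPair.left_of_shortExact (h : IsCotorsionPair 𝒞 𝒟) {S : ShortComplex C}
    (hS : S.ShortExact) (h₁ : 𝒞 S.X₁) (h₃ : 𝒞 S.X₃) : 𝒞 S.X₂ := by
  rw [← h.leftPerp_eq]
  exact fun Y hY ↦ .of_shortExact_left hS (h.extOneVanishes h₁ hY) (h.extOneVanishes h₃ hY)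

variable [EnoughInjectives C]

theorem rightExtPerp_op (𝒟 : ObjectProperty C) : rightExtPerp 𝒟.op = (leftExtPerp 𝒟).op := by
  funext X
  exact propext ⟨fun h Y hY ↦ (extOneVanishes_op_iff _ _).1 (h (Opposite.op Y) hY),
    fun h Y hY ↦ (extOneVanishes_op_iff _ _).2 (h Y.unop hY)⟩

theorem leftExtPerp_op (𝒞 : ObjectProperty C) : leftExtPerp 𝒞.op = (rightExtPerp 𝒞).op := by
  funext X
  exact propext ⟨fun h Y hY ↦ (extOneVanishes_op_iff _ _).1 (h (Opposite.op Y) hY),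
    fun h Y hY ↦ (extOneVanishes_op_iff _ _).2 (h Y.unop hY)⟩

theorem IsCotorsionPair.op (h : IsCotorsionPair 𝒞 𝒟) : IsCotorsionPair 𝒟.op 𝒞.op where
  rightPerp_eq := by rw [rightExtPerp_op, h.leftPerp_eq]
  leftPerp_eq := by rw [leftExtPerp_op, h.rightPerp_eq]

theorem IsCotorsionPair.containsZero_right (h : IsCotorsionPair 𝒞 𝒟) : 𝒟.ContainsZero :=
  have := h.op.containsZero_left
  inferInstanceAs 𝒟.op.unop.ContainsZero

end

theorem isCompletePair_of_iso
    (precover : ∀ M : C, ∃ S : ShortComplex C, S.ShortExact ∧ 𝒞 S.X₂ ∧ 𝒟 S.X₁ ∧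
      Nonempty (S.X₃ ≅ M))
    (preenvelope : ∀ M : C, ∃ S : ShortComplex C, S.ShortExact ∧ 𝒞 S.X₃ ∧ 𝒟 S.X₂ ∧
      Nonempty (S.X₁ ≅ M)) : IsCompletePair 𝒞 𝒟 where
  exists_precover M := by
    obtain ⟨S, hS, hC, hD, ⟨e⟩⟩ := precover M
    refine ⟨S.X₁, S.X₂, S.f, S.g ≫ e.hom, by simp, ?_, hC, hD⟩
    exact ShortComplex.shortExact_of_iso
      (ShortComplex.isoMk (S₁ := S) (Iso.refl _) (Iso.refl _) e (by simp) (by simp)) hS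
  exists_preenvelope M := by
    obtain ⟨S, hS, hC, hD, ⟨e⟩⟩ := preenvelope M
    refine ⟨S.X₂, S.X₃, e.inv ≫ S.f, S.g, by simp, ?_, hC, hD⟩
    exact ShortComplex.shortExact_of_iso
      (ShortComplex.isoMk (S₁ := S) e (Iso.refl _) (Iso.refl _) (by simp) (by simp)) hS

theorem IsCompletePair.op (h : IsCompletePair 𝒞 𝒟) : IsCompletePair 𝒟.op 𝒞.op where
  exists_precover M := by
    obtain ⟨_, _, g, p, w, hS, hC, hD⟩ := h.exists_preenvelope M.unop
    exact ⟨_, _, p.op, g.op, congrArg Quiver.Hom.op w, hS.op, hD, hC⟩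
  exists_preenvelope M := by
    obtain ⟨_, _, k, f, w, hS, hC, hD⟩ := h.exists_precover M.unop
    exact ⟨_, _, f.op, k.op, congrArg Quiver.Hom.op w, hS.op, hD, hC⟩

theorem IsCompletePair.of_op (h : IsCompletePair 𝒟.op 𝒞.op) : IsCompletePair 𝒞 𝒟 where
  exists_precover M := by
    obtain ⟨_, _, g, p, w, hS, hD, hC⟩ := h.exists_preenvelope (Opposite.op M)
    exact ⟨_, _, p.unop, g.unop, congrArg Quiver.Hom.unop w, hS.unop, hC, hD⟩
  exists_preenvelope M := by
    obtain ⟨_, _, k, f, w, hS, hD, hC⟩ := h.exists_precover (Opposite.op M)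
    exact ⟨_, _, f.unop, k.unop, congrArg Quiver.Hom.unop w, hS.unop, hC, hD⟩

theorem IsHereditaryPair.op (h : IsHereditaryPair 𝒞 𝒟) : IsHereditaryPair 𝒟.op 𝒞.op where
  kernel_mem S hS h₂ h₃ := h.cokernel_mem S.unop hS.unop h₃ h₂
  cokernel_mem S hS h₁ h₂ := h.kernel_mem S.unop hS.unop h₂ h₁

theorem IsCompleteHereditaryCotorsionPair.op [EnoughProjectives C] [EnoughInjectives C]
    (h : IsCompleteHereditaryCotorsionPair 𝒞 𝒟) :
    IsCompleteHereditaryCotorsionPair 𝒟.op 𝒞.op where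
  cotorsion := h.cotorsion.op
  complete := h.complete.op
  hereditary := h.hereditary.op

end CotorsionPair

namespace AbelianRecollement

variable {A' : Type u'} [Category.{v'} A'] [Abelian A']
  {A : Type u} [Category.{v} A] [Abelian A]
  {A'' : Type u''} [Category.{v''} A''] [Abelian A'']
  (R : AbelianRecollement A' A A'')

attribute [instance] full_iLowerStar faithful_iLowerStar full_jLowerShriek faithful_jLowerShriek
  full_jLowerStar faithful_jLowerStar

instance preservesFiniteLimits_iLowerStar : PreservesFiniteLimits R.iLowerStar :=
  have := R.adjIStar.rightAdjoint_preservesLimits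
  inferInstance

instance preservesFiniteColimits_iLowerStar : PreservesFiniteColimits R.iLowerStar :=
  have := R.adjIShriek.leftAdjoint_preservesColimits
  inferInstance

instance preservesFiniteLimits_jUpperStar : PreservesFiniteLimits R.jUpperStar :=
  have := R.adjJShriek.rightAdjoint_preservesLimits
  inferInstance

instance preservesFiniteColimits_jUpperStar : PreservesFiniteColimits R.jUpperStar :=
  have := R.adjJStar.leftAdjoint_preservesColimits
  inferInstance

instance preservesFiniteColimits_iUpperStar : PreservesFiniteColimits R.iUpperStar :=
  have := R.adjIStar.leftAdjoint_preservesColimits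
  inferInstance

instance preservesFiniteLimits_iUpperShriek : PreservesFiniteLimits R.iUpperShriek :=
  have := R.adjIShriek.rightAdjoint_preservesLimits
  inferInstance

instance preservesFiniteColimits_jLowerShriek : PreservesFiniteColimits R.jLowerShriek :=
  have := R.adjJShriek.leftAdjoint_preservesColimits
  inferInstance

instance preservesFiniteLimits_jLowerStar : PreservesFiniteLimits R.jLowerStar :=
  have := R.adjJStar.rightAdjoint_preservesLimits
  inferInstance

/-- The opposite recollement, which exchanges `i^*` with `i^!` and `j_!` with `j_*`. -/
def op : AbelianRecollement A'ᵒᵖ Aᵒᵖ A''ᵒᵖ where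
  iUpperStar := R.iUpperShriek.op
  iLowerStar := R.iLowerStar.op
  iUpperShriek := R.iUpperStar.op
  jLowerShriek := R.jLowerStar.op
  jUpperStar := R.jUpperStar.op
  jLowerStar := R.jLowerShriek.op
  adjIStar := R.adjIShriek.op
  adjIShriek := R.adjIStar.op
  adjJShriek := R.adjJStar.op
  adjJStar := R.adjJShriek.op
  full_iLowerStar := inferInstance
  faithful_iLowerStar := inferInstance
  full_jLowerShriek := inferInstance
  faithful_jLowerShriek := inferInstance
  full_jLowerStar := inferInstance
  faithful_jLowerStar := inferInstance
  kernel_eq_image X := by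
    refine Iff.trans ⟨fun h ↦ h.unop, fun h ↦ h.op⟩ ((R.kernel_eq_image X.unop).trans ?_)
    exact ⟨fun ⟨Y, ⟨e⟩⟩ ↦ ⟨Opposite.op Y, ⟨e.symm.op⟩⟩, fun ⟨Y, ⟨e⟩⟩ ↦ ⟨Y.unop, ⟨e.symm.unop⟩⟩⟩

/-- The isomorphism `i^* i_* X ≅ X`. -/
noncomputable def iUpperStarILowerStarIso (X : A') :
    R.iUpperStar.obj (R.iLowerStar.obj X) ≅ X :=
  asIso (R.adjIStar.counit.app X)

/-- The isomorphism `i^! i_* X ≅ X`. -/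
noncomputable def iUpperShriekILowerStarIso (X : A') :
    R.iUpperShriek.obj (R.iLowerStar.obj X) ≅ X :=
  (asIso (R.adjIShriek.unit.app X)).symm

/-- The isomorphism `j^* j_! Y ≅ Y`. -/
noncomputable def jUpperStarJLowerShriekIso (Y : A'') :
    R.jUpperStar.obj (R.jLowerShriek.obj Y) ≅ Y :=
  (asIso (R.adjJShriek.unit.app Y)).symm

theorem isZero_jUpperStar_iLowerStar (X : A') :
    IsZero (R.jUpperStar.obj (R.iLowerStar.obj X)) :=
  (R.kernel_eq_image _).2 (R.iLowerStar.obj_mem_essImage X)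

theorem isZero_iUpperStar_jLowerShriek (Y : A'') :
    IsZero (R.iUpperStar.obj (R.jLowerShriek.obj Y)) := by
  rw [IsZero.iff_id_eq_zero]
  apply (R.adjIStar.homEquiv _ _).injective
  apply (R.adjJShriek.homEquiv _ _).injective
  exact (R.isZero_jUpperStar_iLowerStar _).eq_of_tgt _ _

theorem isIso_unit_of_isZero_jUpperStar {X : A} (hX : IsZero (R.jUpperStar.obj X)) :
    IsIso (R.adjIStar.unit.app X) :=
  R.adjIStar.isIso_unit_app_iff_mem_essImage.2 ((R.kernel_eq_image X).1 hX)

theorem isZero_of_isZero_iUpperStar_of_isZero_jUpperStar {X : A}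
    (hi : IsZero (R.iUpperStar.obj X)) (hj : IsZero (R.jUpperStar.obj X)) : IsZero X :=
  have := R.isIso_unit_of_isZero_jUpperStar hj
  (R.iLowerStar.map_isZero hi).of_iso (asIso (R.adjIStar.unit.app X))

theorem counit_comp_unit (X : A) :
    R.adjJShriek.counit.app X ≫ R.adjIStar.unit.app X = 0 := by
  apply (R.adjJShriek.homEquiv _ _).injective
  exact (R.isZero_jUpperStar_iLowerStar _).eq_of_tgt _ _

/-- The sequence `j_! j^* X ⟶ X ⟶ i_* i^* X` of the counit of `j_! ⊣ j^*` and the unit of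
`i^* ⊣ i_*`. -/
abbrev leftComplex (X : A) : ShortComplex A :=
  .mk (R.adjJShriek.counit.app X) (R.adjIStar.unit.app X) (R.counit_comp_unit X)

theorem epi_unit (X : A) : Epi (R.adjIStar.unit.app X) := by
  let q := cokernel.π (R.adjIStar.unit.app X)
  have hi : IsZero (R.iUpperStar.obj (cokernel (R.adjIStar.unit.app X))) := by
    refine IsZero.of_epi_eq_zero (R.iUpperStar.map q) ?_
    rw [← cancel_epi (R.iUpperStar.map (R.adjIStar.unit.app X)), ← Functor.map_comp,
      cokernel.condition, Functor.map_zero, comp_zero]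
  have hj : IsZero (R.jUpperStar.obj (cokernel (R.adjIStar.unit.app X))) :=
    (R.isZero_jUpperStar_iLowerStar _).of_epi (R.jUpperStar.map q)
  exact Preadditive.epi_of_isZero_cokernel _
    (R.isZero_of_isZero_iUpperStar_of_isZero_jUpperStar hi hj)

theorem exact_leftComplex (X : A) : (R.leftComplex X).Exact := by
  let q : X ⟶ cokernel (R.adjJShriek.counit.app X) := cokernel.π _
  have hj : IsZero (R.jUpperStar.obj (cokernel (R.adjJShriek.counit.app X))) := by
    refine IsZero.of_epi_eq_zero (R.jUpperStar.map q) ?_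
    rw [← cancel_epi (R.jUpperStar.map (R.adjJShriek.counit.app X)), ← Functor.map_comp,
      cokernel.condition, Functor.map_zero, comp_zero]
  have := R.isIso_unit_of_isZero_jUpperStar hj
  rw [ShortComplex.exact_iff_exact_up_to_refinements]
  intro T (x : T ⟶ X) (hx : x ≫ R.adjIStar.unit.app X = 0)
  have hq : q ≫ R.adjIStar.unit.app (cokernel (R.adjJShriek.counit.app X)) =
    R.adjIStar.unit.app X ≫ R.iLowerStar.map (R.iUpperStar.map q) := R.adjIStar.unit.naturality q
  have hxq : x ≫ q = 0 := by
    rw [← cancel_mono (R.adjIStar.unit.app (cokernel (R.adjJShriek.counit.app X))), Category.assoc,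
      hq, reassoc_of% hx, zero_comp, zero_comp]
  exact (ShortComplex.exact_cokernel (R.adjJShriek.counit.app X)).exact_up_to_refinements x hxq

theorem isZero_leftDerived_iUpperStar_of_mono_counit [EnoughProjectives A] (X : A)
    [Mono (R.adjJShriek.counit.app X)] : IsZero ((R.iUpperStar.leftDerived 1).obj X) := by
  obtain ⟨S, hS, hP, rfl⟩ := exists_projective_presentation X
  have := hS.mono_f
  have := hS.epi_g
  have : Mono (S.map (𝟭 A)).f := inferInstanceAs (Mono S.f)
  have : Mono (S.mapNatTrans R.adjJShriek.counit).τ₃ :=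
    inferInstanceAs (Mono (R.adjJShriek.counit.app S.X₃))
  have : Epi (S.mapNatTrans R.adjIStar.unit).τ₁ := R.epi_unit S.X₁
  have : Epi (S.map R.jUpperStar).g := inferInstanceAs (Epi (R.jUpperStar.map S.g))
  have exact_jj : (S.map (R.jUpperStar ⋙ R.jLowerShriek)).Exact :=
    (hS.map_of_exact R.jUpperStar).exact.map_of_epi_of_preservesCokernel R.jLowerShriek
      inferInstance inferInstance
  have mono_ii : Mono (S.map (R.iUpperStar ⋙ R.iLowerStar)).f :=
    mono_f_of_exact_columns (S.mapNatTrans R.adjJShriek.counit) (S.mapNatTrans R.adjIStar.unit)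
      (ShortComplex.hom_ext _ _ (R.counit_comp_unit _) (R.counit_comp_unit _)
        (R.counit_comp_unit _)) exact_jj (R.exact_leftComplex S.X₂)
  exact (isZero_leftDerived_one_iff R.iUpperStar hS).2 (R.iLowerStar.mono_of_mono_map mono_ii)

theorem isZero_leftDerived_iUpperStar_iLowerStar [EnoughProjectives A] (X : A') :
    IsZero ((R.iUpperStar.leftDerived 1).obj (R.iLowerStar.obj X)) :=
  have : Mono (R.adjJShriek.counit.app (R.iLowerStar.obj X)) :=
    (R.jLowerShriek.map_isZero (R.isZero_jUpperStar_iLowerStar X)).mono _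
  R.isZero_leftDerived_iUpperStar_of_mono_counit _

theorem isZero_leftDerived_iUpperStar_jLowerShriek [EnoughProjectives A] (Y : A'') :
    IsZero ((R.iUpperStar.leftDerived 1).obj (R.jLowerShriek.obj Y)) :=
  R.isZero_leftDerived_iUpperStar_of_mono_counit _

theorem isZero_rightDerived_iUpperShriek_iLowerStar [EnoughInjectives A] (X : A') :
    IsZero ((R.iUpperShriek.rightDerived 1).obj (R.iLowerStar.obj X)) :=
  (isZero_leftDerived_one_op_iff R.iUpperShriek _).1
    (R.op.isZero_leftDerived_iUpperStar_iLowerStar (Opposite.op X))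

theorem mono_of_isZero_leftDerived_iUpperStar [EnoughProjectives A] {Y : A''} {K : A}
    (f : R.jLowerShriek.obj Y ⟶ K) [Epi f] [Mono (R.jUpperStar.map f)]
    (hK : IsZero ((R.iUpperStar.leftDerived 1).obj K)) : Mono f := by
  let S : ShortComplex A := .mk (kernel.ι f) f (kernel.condition f)
  have hS : S.ShortExact := { exact := ShortComplex.exact_kernel f }
  have : Mono (R.iUpperStar.map S.f) :=
    (shortExact_map_of_isZero_leftDerived R.iUpperStar hS hK).mono_f
  have hi : IsZero (R.iUpperStar.obj (kernel f)) :=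
    (R.isZero_iUpperStar_jLowerShriek Y).of_mono (R.iUpperStar.map S.f)
  have hj : IsZero (R.jUpperStar.obj (kernel f)) := by
    refine IsZero.of_mono_eq_zero (R.jUpperStar.map (kernel.ι f)) ?_
    rw [← cancel_mono (R.jUpperStar.map f), ← Functor.map_comp, kernel.condition,
      Functor.map_zero, zero_comp]
  exact Preadditive.mono_of_isZero_kernel f
    (R.isZero_of_isZero_iUpperStar_of_isZero_jUpperStar hi hj)

theorem shortExact_leftComplex_of_isZero_leftDerived_kernel [EnoughProjectives A] {X : A}
    (hX : IsZero ((R.iUpperStar.leftDerived 1).obj (kernel (R.adjIStar.unit.app X)))) :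
    (R.leftComplex X).ShortExact := by
  let p : R.jLowerShriek.obj (R.jUpperStar.obj X) ⟶ kernel (R.adjIStar.unit.app X) :=
    kernel.lift _ (R.adjJShriek.counit.app X) (R.counit_comp_unit X)
  have hp : p ≫ kernel.ι _ = R.adjJShriek.counit.app X := kernel.lift_ι _ _ _
  have : Epi p := (R.exact_leftComplex X).epi_kernelLift
  have : Mono (R.jUpperStar.map p) := by
    have : Mono (R.jUpperStar.map p ≫ R.jUpperStar.map (kernel.ι _)) := by
      rw [← Functor.map_comp, hp]
      infer_instance
    exact mono_of_mono _ (R.jUpperStar.map (kernel.ι _))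
  have : Mono p := R.mono_of_isZero_leftDerived_iUpperStar p hX
  have mono_counit : Mono (R.adjJShriek.counit.app X) := hp ▸ mono_comp p (kernel.ι _)
  exact
    { exact := R.exact_leftComplex X
      mono_f := mono_counit
      epi_g := R.epi_unit X }

theorem extOneVanishes_iLowerStar_iff [EnoughProjectives A] [EnoughProjectives A'] (X Y : A') :
    ExtOneVanishes (R.iLowerStar.obj X) (R.iLowerStar.obj Y) ↔ ExtOneVanishes X Y :=
  (extOneVanishes_obj_iff_of_isZero_leftDerived R.adjIStar
      (R.isZero_leftDerived_iUpperStar_iLowerStar X) Y).symm.trans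
    (extOneVanishes_congr_left (R.iUpperStarILowerStarIso X) Y)

theorem extOneVanishes_jLowerShriek_jLowerStar_iff [EnoughProjectives A] [EnoughProjectives A'']
    (X Y : A'') :
    ExtOneVanishes (R.jLowerShriek.obj X) (R.jLowerStar.obj Y) ↔ ExtOneVanishes X Y := by
  obtain ⟨T, hT, hP, rfl⟩ := exists_projective_presentation X
  have := hT.epi_g
  let S : ShortComplex A :=
    .mk (kernel.ι (R.jLowerShriek.map T.g)) (R.jLowerShriek.map T.g) (kernel.condition _)
  have hS : S.ShortExact := { exact := ShortComplex.exact_kernel _ }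
  have : Projective S.X₂ := R.adjJShriek.map_projective _ hP
  have : Projective (R.jUpperStar.obj S.X₂) :=
    Projective.of_iso (R.jUpperStarJLowerShriekIso T.X₂).symm hP
  exact (extOneVanishes_obj_iff_of_shortExact_map R.adjJStar hS
      (hS.map_of_exact R.jUpperStar) Y).symm.trans
    (extOneVanishes_congr_left (R.jUpperStarJLowerShriekIso T.X₃) Y)

theorem gluedM_op [EnoughInjectives A] (V' : ObjectProperty A') (V'' : ObjectProperty A'') :
    R.op.gluedM V'.op V''.op = (R.gluedN V' V'').op :=
  funext fun X ↦ propext (and_congr_right' (and_congr_right'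
    (isZero_leftDerived_one_op_iff R.iUpperShriek X.unop)))

theorem gluedN_op [EnoughProjectives A] (U' : ObjectProperty A') (U'' : ObjectProperty A'') :
    R.op.gluedN U'.op U''.op = (R.gluedM U' U'').op :=
  funext fun X ↦ propext (and_congr_right' (and_congr_right'
    (isZero_rightDerived_one_op_iff R.iUpperStar X.unop)))

section Glued

variable {U' V' : ObjectProperty A'} {U'' V'' : ObjectProperty A''}

theorem containsZero_of_gluedM [EnoughProjectives A] (h : (R.gluedM U' U'').ContainsZero) :
    U'.ContainsZero ∧ U''.ContainsZero := by
  obtain ⟨Z, hZ, hi, hj, _⟩ := h.exists_zero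
  exact ⟨⟨_, R.iUpperStar.map_isZero hZ, hi⟩, ⟨_, R.jUpperStar.map_isZero hZ, hj⟩⟩

theorem gluedM_iLowerStar_iff [EnoughProjectives A] [U'.IsClosedUnderIsomorphisms]
    [U''.IsClosedUnderIsomorphisms] (h : (R.gluedM U' U'').ContainsZero) (X : A') :
    R.gluedM U' U'' (R.iLowerStar.obj X) ↔ U' X := by
  obtain ⟨_, _⟩ := R.containsZero_of_gluedM h
  let e := R.iUpperStarILowerStarIso X
  exact ⟨fun hX ↦ U'.prop_of_iso e hX.1, fun hX ↦ ⟨U'.prop_of_iso e.symm hX,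
    U''.prop_of_isZero (R.isZero_jUpperStar_iLowerStar X),
    R.isZero_leftDerived_iUpperStar_iLowerStar X⟩⟩

theorem gluedM_jLowerShriek_iff [EnoughProjectives A] [U'.IsClosedUnderIsomorphisms]
    [U''.IsClosedUnderIsomorphisms] (h : (R.gluedM U' U'').ContainsZero) (Y : A'') :
    R.gluedM U' U'' (R.jLowerShriek.obj Y) ↔ U'' Y := by
  obtain ⟨_, _⟩ := R.containsZero_of_gluedM h
  let e := R.jUpperStarJLowerShriekIso Y
  exact ⟨fun hY ↦ U''.prop_of_iso e hY.2.1, fun hY ↦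
    ⟨U'.prop_of_isZero (R.isZero_iUpperStar_jLowerShriek Y), U''.prop_of_iso e.symm hY,
      R.isZero_leftDerived_iUpperStar_jLowerShriek Y⟩⟩

theorem gluedN_iLowerStar_iff [EnoughInjectives A] [V'.IsClosedUnderIsomorphisms]
    [V''.IsClosedUnderIsomorphisms] (h : (R.gluedN V' V'').ContainsZero) (X : A') :
    R.gluedN V' V'' (R.iLowerStar.obj X) ↔ V' X := by
  have h_op : (R.op.gluedM V'.op V''.op).ContainsZero := by
    rw [gluedM_op]
    infer_instance
  exact (iff_of_eq (congrFun (R.gluedM_op V' V'') _)).symm.trans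
    (R.op.gluedM_iLowerStar_iff h_op (Opposite.op X))

theorem gluedN_jLowerStar_iff [EnoughInjectives A] [V'.IsClosedUnderIsomorphisms]
    [V''.IsClosedUnderIsomorphisms] (h : (R.gluedN V' V'').ContainsZero) (Y : A'') :
    R.gluedN V' V'' (R.jLowerStar.obj Y) ↔ V'' Y := by
  have h_op : (R.op.gluedM V'.op V''.op).ContainsZero := by
    rw [gluedM_op]
    infer_instance
  exact (iff_of_eq (congrFun (R.gluedM_op V' V'') _)).symm.trans
    (R.op.gluedM_jLowerShriek_iff h_op (Opposite.op Y))

theorem shortExact_leftComplex_of_gluedM [EnoughProjectives A]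
    [U'.IsClosedUnderIsomorphisms] [U''.IsClosedUnderIsomorphisms] {𝒟 : ObjectProperty A}
    (h : IsHereditaryPair (R.gluedM U' U'') 𝒟) (hM : (R.gluedM U' U'').ContainsZero) {X : A}
    (hX : R.gluedM U' U'' X) : (R.leftComplex X).ShortExact := by
  have mem_iiX : R.gluedM U' U'' (R.iLowerStar.obj (R.iUpperStar.obj X)) :=
    (R.gluedM_iLowerStar_iff hM _).2 hX.1
  have := R.epi_unit X
  have mem_kernel : R.gluedM U' U'' (kernel (R.adjIStar.unit.app X)) :=
    h.kernel_mem (.mk _ _ (kernel.condition _)) { exact := ShortComplex.exact_kernel _ } hX mem_iiX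
  exact R.shortExact_leftComplex_of_isZero_leftDerived_kernel mem_kernel.2.2

end Glued

end AbelianRecollement

section GluedPair

variable {A' : Type u'} [Category.{v'} A'] [Abelian A']
  {A : Type u} [Category.{v} A] [Abelian A] [EnoughProjectives A] [EnoughInjectives A]
  {A'' : Type u''} [Category.{v''} A''] [Abelian A''] {R : AbelianRecollement A' A A''}
  {U' V' : ObjectProperty A'} {U'' V'' : ObjectProperty A''}

theorem IsCotorsionPair.glued_op (h : IsCotorsionPair (R.gluedM U' U'') (R.gluedN V' V'')) :
    IsCotorsionPair (R.op.gluedM V'.op V''.op) (R.op.gluedN U'.op U''.op) := by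
  rw [R.gluedM_op, R.gluedN_op]
  exact h.op

theorem IsCotorsionPair.rightExtPerp_closedPart_le [EnoughProjectives A']
    [V'.IsClosedUnderIsomorphisms] [V''.IsClosedUnderIsomorphisms]
    (h : IsCotorsionPair (R.gluedM U' U'') (R.gluedN V' V'')) : rightExtPerp U' ≤ V' := by
  intro Y hY
  have mem_iY : R.gluedN V' V'' (R.iLowerStar.obj Y) := h.rightPerp_eq.le _ fun C hC ↦
    (extOneVanishes_obj_iff_of_isZero_leftDerived R.adjIStar hC.2.2 Y).1 (hY _ hC.1)
  exact (R.gluedN_iLowerStar_iff h.containsZero_right Y).1 mem_iY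

theorem IsCotorsionPair.leftExtPerp_openPart_le [EnoughProjectives A'']
    [U'.IsClosedUnderIsomorphisms] [U''.IsClosedUnderIsomorphisms]
    (h : IsCotorsionPair (R.gluedM U' U'') (R.gluedN V' V''))
    (hL : ∀ Y, leftExtPerp V'' Y → IsZero ((R.jLowerShriek.leftDerived 1).obj Y)) :
    leftExtPerp V'' ≤ U'' := by
  intro X hX
  have mem_jX : R.gluedM U' U'' (R.jLowerShriek.obj X) := h.leftPerp_eq.le _ fun D hD ↦
    (extOneVanishes_obj_iff_of_isZero_leftDerived R.adjJShriek (hL X hX) D).2 (hX _ hD.2.1)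
  exact (R.gluedM_jLowerShriek_iff h.containsZero_left X).1 mem_jX

theorem IsCotorsionPair.rightExtPerp_openPart_le [EnoughProjectives A''] [EnoughInjectives A'']
    [V'.IsClosedUnderIsomorphisms] [V''.IsClosedUnderIsomorphisms]
    (h : IsCotorsionPair (R.gluedM U' U'') (R.gluedN V' V''))
    (hR : ∀ Y, rightExtPerp U'' Y → IsZero ((R.jLowerStar.rightDerived 1).obj Y)) :
    rightExtPerp U'' ≤ V'' := by
  rw [← ObjectProperty.op_monotone_iff, ← leftExtPerp_op]
  refine h.glued_op.leftExtPerp_openPart_le fun Y hY ↦ ?_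
  rw [leftExtPerp_op] at hY
  exact (isZero_leftDerived_one_op_iff R.jLowerStar _).2 (hR _ hY)

theorem IsCompletePair.openPart
    (h : IsCompletePair (R.gluedM U' U'') (R.gluedN V' V'')) : IsCompletePair U'' V'' := by
  refine isCompletePair_of_iso (fun M ↦ ?_) (fun M ↦ ?_)
  · obtain ⟨_, _, k, f, w, hS, hC, hD⟩ := h.exists_precover (R.jLowerShriek.obj M)
    exact ⟨_, hS.map_of_exact R.jUpperStar, hC.2.1, hD.2.1, ⟨R.jUpperStarJLowerShriekIso M⟩⟩
  · obtain ⟨_, _, g, p, w, hS, hC, hD⟩ := h.exists_preenvelope (R.jLowerShriek.obj M)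
    exact ⟨_, hS.map_of_exact R.jUpperStar, hC.2.1, hD.2.1, ⟨R.jUpperStarJLowerShriekIso M⟩⟩

theorem IsCompletePair.closedPart_of_jLowerShriek [EnoughProjectives A']
    [U'.IsClosedUnderIsomorphisms]
    (h : IsCompletePair (R.gluedM U' U'') (R.gluedN V' V''))
    (hM : ∀ X, R.gluedM U' U'' X → (R.leftComplex X).ShortExact)
    (hUV : IsCotorsionPair U' V')
    (hj : ∀ Y, U'' Y → U' (R.iUpperShriek.obj (R.jLowerShriek.obj Y)) ∧
      IsZero ((R.iUpperShriek.rightDerived 1).obj (R.jLowerShriek.obj Y))) :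
    IsCompletePair U' V' := by
  have mem_iUpperShriek {X : A} (hX : R.gluedM U' U'' X) : U' (R.iUpperShriek.obj X) := by
    obtain ⟨mem_ijX, isZero_jX⟩ := hj _ hX.2.1
    exact hUV.left_of_shortExact
      (shortExact_map_of_isZero_rightDerived R.iUpperShriek (hM X hX) isZero_jX) mem_ijX
      (U'.prop_of_iso (R.iUpperShriekILowerStarIso _).symm hX.1)
  refine isCompletePair_of_iso (fun M ↦ ?_) (fun M ↦ ?_)
  · obtain ⟨_, _, k, f, w, hS, hC, hD⟩ := h.exists_precover (R.iLowerStar.obj M)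
    exact ⟨_, shortExact_map_of_isZero_rightDerived R.iUpperShriek hS hD.2.2,
      mem_iUpperShriek hC, hD.1, ⟨R.iUpperShriekILowerStarIso M⟩⟩
  · obtain ⟨_, _, g, p, w, hS, hC, hD⟩ := h.exists_preenvelope (R.iLowerStar.obj M)
    exact ⟨_, shortExact_map_of_isZero_rightDerived R.iUpperShriek hS
        (R.isZero_rightDerived_iUpperShriek_iLowerStar M),
      mem_iUpperShriek hC, hD.1, ⟨R.iUpperShriekILowerStarIso M⟩⟩

variable [U'.IsClosedUnderIsomorphisms] [U''.IsClosedUnderIsomorphisms]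
  [V'.IsClosedUnderIsomorphisms] [V''.IsClosedUnderIsomorphisms]

theorem IsCotorsionPair.closedPart [EnoughProjectives A'] [EnoughInjectives A']
    (h : IsCotorsionPair (R.gluedM U' U'') (R.gluedN V' V'')) : IsCotorsionPair U' V' := by
  refine .of_le (fun X Y hX hY ↦ ?_) h.rightExtPerp_closedPart_le ?_
  · exact (R.extOneVanishes_iLowerStar_iff X Y).1 (h.extOneVanishes
      ((R.gluedM_iLowerStar_iff h.containsZero_left X).2 hX)
      ((R.gluedN_iLowerStar_iff h.containsZero_right Y).2 hY))
  · rw [← ObjectProperty.op_monotone_iff, ← rightExtPerp_op]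
    exact h.glued_op.rightExtPerp_closedPart_le

theorem IsCotorsionPair.openPart [EnoughProjectives A''] [EnoughInjectives A'']
    (h : IsCotorsionPair (R.gluedM U' U'') (R.gluedN V' V''))
    (hR : ∀ Y, rightExtPerp U'' Y → IsZero ((R.jLowerStar.rightDerived 1).obj Y))
    (hL : ∀ Y, leftExtPerp V'' Y → IsZero ((R.jLowerShriek.leftDerived 1).obj Y)) :
    IsCotorsionPair U'' V'' :=
  .of_le (fun X Y hX hY ↦ (R.extOneVanishes_jLowerShriek_jLowerStar_iff X Y).1 <|
      h.extOneVanishes ((R.gluedM_jLowerShriek_iff h.containsZero_left X).2 hX)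
        ((R.gluedN_jLowerStar_iff h.containsZero_right Y).2 hY))
    (h.rightExtPerp_openPart_le hR) (h.leftExtPerp_openPart_le hL)

theorem IsHereditaryPair.closedPart
    (h : IsHereditaryPair (R.gluedM U' U'') (R.gluedN V' V''))
    (hM : (R.gluedM U' U'').ContainsZero) (hN : (R.gluedN V' V'').ContainsZero) :
    IsHereditaryPair U' V' where
  kernel_mem _ hS h₂ h₃ := (R.gluedM_iLowerStar_iff hM _).1 <|
    h.kernel_mem _ (hS.map_of_exact R.iLowerStar) ((R.gluedM_iLowerStar_iff hM _).2 h₂)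
      ((R.gluedM_iLowerStar_iff hM _).2 h₃)
  cokernel_mem _ hS h₁ h₂ := (R.gluedN_iLowerStar_iff hN _).1 <|
    h.cokernel_mem _ (hS.map_of_exact R.iLowerStar) ((R.gluedN_iLowerStar_iff hN _).2 h₁)
      ((R.gluedN_iLowerStar_iff hN _).2 h₂)

theorem IsHereditaryPair.openPart [EnoughProjectives A''] [EnoughInjectives A'']
    (h : IsHereditaryPair (R.gluedM U' U'') (R.gluedN V' V''))
    (hM : (R.gluedM U' U'').ContainsZero) (hN : (R.gluedN V' V'').ContainsZero)
    (hU : ∀ Y, U'' Y → IsZero ((R.jLowerShriek.leftDerived 1).obj Y))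
    (hV : ∀ Y, V'' Y → IsZero ((R.jLowerStar.rightDerived 1).obj Y)) :
    IsHereditaryPair U'' V'' where
  kernel_mem _ hS h₂ h₃ := (R.gluedM_jLowerShriek_iff hM _).1 <|
    h.kernel_mem _ (shortExact_map_of_isZero_leftDerived R.jLowerShriek hS (hU _ h₃))
      ((R.gluedM_jLowerShriek_iff hM _).2 h₂) ((R.gluedM_jLowerShriek_iff hM _).2 h₃)
  cokernel_mem _ hS h₁ h₂ := (R.gluedN_jLowerStar_iff hN _).1 <|
    h.cokernel_mem _ (shortExact_map_of_isZero_rightDerived R.jLowerStar hS (hV _ h₁))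
      ((R.gluedN_jLowerStar_iff hN _).2 h₁) ((R.gluedN_jLowerStar_iff hN _).2 h₂)

theorem IsCompleteHereditaryCotorsionPair.isCompletePair_closedPart_of_jLowerShriek
    [EnoughProjectives A'] [EnoughInjectives A']
    (h : IsCompleteHereditaryCotorsionPair (R.gluedM U' U'') (R.gluedN V' V''))
    (hj : ∀ Y, U'' Y → U' (R.iUpperShriek.obj (R.jLowerShriek.obj Y)) ∧
      IsZero ((R.iUpperShriek.rightDerived 1).obj (R.jLowerShriek.obj Y))) :
    IsCompletePair U' V' :=
  h.complete.closedPart_of_jLowerShriek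
    (fun _ ↦ R.shortExact_leftComplex_of_gluedM h.hereditary h.cotorsion.containsZero_left)
    h.cotorsion.closedPart hj

theorem IsCompleteHereditaryCotorsionPair.isCompletePair_closedPart_of_jLowerStar
    [EnoughProjectives A'] [EnoughInjectives A']
    (h : IsCompleteHereditaryCotorsionPair (R.gluedM U' U'') (R.gluedN V' V''))
    (hj : ∀ Y, V'' Y → V' (R.iUpperStar.obj (R.jLowerStar.obj Y)) ∧
      IsZero ((R.iUpperStar.leftDerived 1).obj (R.jLowerStar.obj Y))) :
    IsCompletePair U' V' := by
  have h_op : IsCompleteHereditaryCotorsionPair (R.op.gluedM V'.op V''.op)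
      (R.op.gluedN U'.op U''.op) := by
    rw [R.gluedM_op, R.gluedN_op]
    exact h.op
  refine .of_op (h_op.isCompletePair_closedPart_of_jLowerShriek fun Y hY ↦ ?_)
  obtain ⟨mem_ijY, isZero_jY⟩ := hj _ hY
  exact ⟨mem_ijY, (isZero_rightDerived_one_op_iff R.iUpperStar _).2 isZero_jY⟩

end GluedPair

theorem proposition3p13_general
    {A' : Type u'} [Category.{v'} A'] [Abelian A'] [EnoughProjectives A'] [EnoughInjectives A']
    {A : Type u} [Category.{v} A] [Abelian A] [EnoughProjectives A] [EnoughInjectives A]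
    {A'' : Type u''} [Category.{v''} A''] [Abelian A''] [EnoughProjectives A'']
    [EnoughInjectives A'']
    (R : AbelianRecollement A' A A'')
    (U' V' : ObjectProperty A') (U'' V'' : ObjectProperty A'')
    [U'.IsClosedUnderIsomorphisms] [V'.IsClosedUnderIsomorphisms]
    [U''.IsClosedUnderIsomorphisms] [V''.IsClosedUnderIsomorphisms]
    (hMN : IsCompleteHereditaryCotorsionPair (R.gluedM U' U'') (R.gluedN V' V''))
    (hR : ∀ Y : A'', rightExtPerp U'' Y → IsZero ((R.jLowerStar.rightDerived 1).obj Y))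
    (hL : ∀ Y : A'', leftExtPerp V'' Y → IsZero ((R.jLowerShriek.leftDerived 1).obj Y))
    (h : (∀ Y : A'', V'' Y → V' (R.iUpperStar.obj (R.jLowerStar.obj Y)) ∧
          IsZero ((R.iUpperStar.leftDerived 1).obj (R.jLowerStar.obj Y))) ∨
      (∀ Y : A'', U'' Y → U' (R.iUpperShriek.obj (R.jLowerShriek.obj Y)) ∧
          IsZero ((R.iUpperShriek.rightDerived 1).obj (R.jLowerShriek.obj Y)))) :
    IsCompleteHereditaryCotorsionPair U' V' ∧ IsCompleteHereditaryCotorsionPair U'' V'' := by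
  have closedPart := hMN.cotorsion.closedPart
  have openPart := hMN.cotorsion.openPart hR hL
  have hM := hMN.cotorsion.containsZero_left
  have hN := hMN.cotorsion.containsZero_right
  refine ⟨⟨closedPart, ?_, hMN.hereditary.closedPart hM hN⟩, ⟨openPart, hMN.complete.openPart, ?_⟩⟩
  · obtain h | h := h
    · exact hMN.isCompletePair_closedPart_of_jLowerStar h
    · exact hMN.isCompletePair_closedPart_of_jLowerShriek h
  · exact hMN.hereditary.openPart hM hN (fun Y hY ↦ hL Y (openPart.leftPerp_eq.ge Y hY))
      fun Y hY ↦ hR Y (openPart.rightPerp_eq.ge Y hY)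

theorem proposition3p13
    {A' : Type u'} [Category.{v'} A'] [Abelian A'] [EnoughProjectives A'] [EnoughInjectives A']
    {A : Type u} [Category.{v} A] [Abelian A] [EnoughProjectives A] [EnoughInjectives A]
    {A'' : Type u''} [Category.{v''} A''] [Abelian A''] [EnoughProjectives A'']
    [EnoughInjectives A'']
    (R : AbelianRecollement A' A A'') (hP : R.ConditionP)
    (U' V' : ObjectProperty A') (U'' V'' : ObjectProperty A'')
    [U'.IsClosedUnderIsomorphisms] [V'.IsClosedUnderIsomorphisms]
    [U''.IsClosedUnderIsomorphisms] [V''.IsClosedUnderIsomorphisms]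
    (hMN : IsCompleteHereditaryCotorsionPair (R.gluedM U' U'') (R.gluedN V' V''))
    (hR : ∀ Y : A'', rightExtPerp U'' Y → IsZero ((R.jLowerStar.rightDerived 1).obj Y))
    (hL : ∀ Y : A'', leftExtPerp V'' Y → IsZero ((R.jLowerShriek.leftDerived 1).obj Y))
    (hLR : (∀ Y : A'', U'' Y → IsZero ((R.jLowerShriek.leftDerived 1).obj Y)) ∨
      (∀ Y : A'', V'' Y → IsZero ((R.jLowerStar.rightDerived 1).obj Y)))
    (h : (∀ Y : A'', V'' Y → V' (R.iUpperStar.obj (R.jLowerStar.obj Y)) ∧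
          IsZero ((R.iUpperStar.leftDerived 1).obj (R.jLowerStar.obj Y))) ∨
      (∀ Y : A'', U'' Y → U' (R.iUpperShriek.obj (R.jLowerShriek.obj Y)) ∧
          IsZero ((R.iUpperShriek.rightDerived 1).obj (R.jLowerShriek.obj Y)))) :
    IsCompleteHereditaryCotorsionPair U' V' ∧ IsCompleteHereditaryCotorsionPair U'' V'' :=
  proposition3p13_general R U' V' U'' V'' hMN hR hL h
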